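/- Let $\Bbbk$ be an algebraically closed field of characteristic zero. For $n\ge 2$ let $V_n$ be the $\Bbbk$-algebra generated by $x_1,\dots,x_n$ subject to the relations $x_ix_j+x_jx_i=0$ for $i\neq j$, and let the symmetric group $S_n$ act on $V_n$ by $\Bbbk$-algebra automorphisms with $\sigma(x_i)=x_{\sigma(i)}$. For a finite group $G$ acting on a $\Bbbk$-algebra $A$ by $\Bbbk$-algebra automorphisms, let $A\# G$ be the skew group algebra, that is, $A\otimes \Bbbk G$ with multiplication $(a\# g)(b\# h)=a\,g(b)\# gh$, let $(f_G)$ be its two-sided ideal generated by $f_G=\sum_{g\in G}1\# g$, and define the pertinency $$\mathsf p(A,G)=\operatorname{GKdim} A-\operatorname{GKdim}\,(A\# G)/(f_G),$$ where $\operatorname{GKdim}$ denotes Gelfand--Kirillov dimension over $\Bbbk$. Then $\mathsf p(V_n,S_n)=2$ for every $n\ge 2$. -/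

import Mathlib

open Filter

noncomputable section

/-- The Gelfand-Kirillov dimension of an algebra `A` over a field `k`:
the supremum, over all finite-dimensional subspaces `V` of `A` that contain `1`, of
`limsup_{N → ∞} log (dim V ^ N) / log N`. Here `V ^ N` is the span of all `N`-fold products of
elements of `V`; as `1 ∈ V`, it contains all `V ^ i` with `i ≤ N`. -/
def gkDim (k A : Type*) [Field k] [Ring A] [Algebra k A] : EReal :=
  ⨆ V : {V : Submodule k A // V.FG ∧ (1 : A) ∈ V},
    limsup (fun N : ℕ =>
      ((Real.log (Module.finrank k ↥(V.1 ^ N)) / Real.log N : ℝ) : EReal)) atTop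

/-- The element `f_G = ∑ g, 1 # g` of the skew group algebra `A # G`. In
`SkewMonoidAlgebra A G` the element `single g a` is `a # g`, and
`(a # g) * (b # h) = (a * (g • b)) # (g * h)`. -/
def skewGroupSum (A G : Type*) [Ring A] [Group G] [Fintype G] [MulSemiringAction G A] :
    SkewMonoidAlgebra A G :=
  ∑ g : G, SkewMonoidAlgebra.single g (1 : A)

/-- The algebra `(A # G) / (f_G)`, the quotient of the skew group algebra by the two-sided ideal
generated by `f_G`. -/
abbrev PertinencyQuotient (A G : Type*) [Ring A] [Group G] [Fintype G]
    [MulSemiringAction G A] : Type _ :=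
  (TwoSidedIdeal.span {skewGroupSum A G}).ringCon.Quotient

/-- The pertinency `p(A, G) = GKdim A - GKdim ((A # G) / (f_G))` of an action of a finite group
`G` on `A` by `k`-algebra automorphisms. A difference of extended reals equals a real number only
if both terms are real numbers. -/
def pertinency (k A G : Type*) [Field k] [Ring A] [Algebra k A] [Group G] [Fintype G]
    [MulSemiringAction G A] [SMulCommClass G k A] : EReal :=
  gkDim k A - gkDim k (PertinencyQuotient A G)

/-- The defining relations `x_i x_j + x_j x_i = 0`, `i ≠ j`. -/
inductive SkewPolyRel (k : Type*) [Field k] (n : ℕ) :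
    FreeAlgebra k (Fin n) → FreeAlgebra k (Fin n) → Prop
  | anticomm (i j : Fin n) (h : i ≠ j) : SkewPolyRel k n
      (FreeAlgebra.ι k i * FreeAlgebra.ι k j + FreeAlgebra.ι k j * FreeAlgebra.ι k i) 0

/-- The `(-1)`-skew polynomial algebra `V_n` over `k`: generators `x_1, …, x_n` (indexed here by
`Fin n`) and relations `x_i x_j + x_j x_i = 0` for `i ≠ j`. -/
def SkewPoly (k : Type*) [Field k] (n : ℕ) : Type _ := RingQuot (SkewPolyRel k n)

namespace SkewPoly

instance (k : Type*) [Field k] (n : ℕ) : Ring (SkewPoly k n) :=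
  inferInstanceAs (Ring (RingQuot (SkewPolyRel k n)))

instance (k : Type*) [Field k] (n : ℕ) : Algebra k (SkewPoly k n) :=
  inferInstanceAs (Algebra k (RingQuot (SkewPolyRel k n)))

/-- The quotient map from the free algebra. -/
def mk (k : Type*) [Field k] (n : ℕ) : FreeAlgebra k (Fin n) →ₐ[k] SkewPoly k n :=
  RingQuot.mkAlgHom k (SkewPolyRel k n)

/-- The generator `x_i`. -/
def X (k : Type*) [Field k] {n : ℕ} (i : Fin n) : SkewPoly k n :=
  mk k n (FreeAlgebra.ι k i)

theorem X_anticomm (k : Type*) [Field k] {n : ℕ} {i j : Fin n} (h : i ≠ j) :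
    X k i * X k j + X k j * X k i = 0 := by
  have := RingQuot.mkAlgHom_rel k (SkewPolyRel.anticomm (k := k) i j h)
  rw [map_add, map_mul, map_mul, map_zero] at this
  exact this

/-- The universal property of `V_n`. -/
def lift {k : Type*} [Field k] {n : ℕ} {B : Type*} [Ring B] [Algebra k B] (f : Fin n → B)
    (hf : ∀ i j, i ≠ j → f i * f j + f j * f i = 0) : SkewPoly k n →ₐ[k] B :=
  RingQuot.liftAlgHom k ⟨FreeAlgebra.lift k f, by
    rintro _ _ ⟨i, j, h⟩
    simpa using hf i j h⟩

theorem lift_X {k : Type*} [Field k] {n : ℕ} {B : Type*} [Ring B] [Algebra k B] (f : Fin n → B)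
    (hf : ∀ i j, i ≠ j → f i * f j + f j * f i = 0) (i : Fin n) :
    lift (k := k) f hf (X k i) = f i := by
  have := RingQuot.liftAlgHom_mkAlgHom_apply k (FreeAlgebra.lift k f)
    (s := SkewPolyRel k n) (by rintro _ _ ⟨i, j, h⟩; simpa using hf i j h) (FreeAlgebra.ι k i)
  rw [FreeAlgebra.lift_ι_apply] at this
  exact this

theorem hom_ext {k : Type*} [Field k] {n : ℕ} {B : Type*} [Ring B] [Algebra k B]
    {f g : SkewPoly k n →ₐ[k] B} (h : ∀ i, f (X k i) = g (X k i)) : f = g := by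
  refine RingQuot.ringQuot_ext' k (s := SkewPolyRel k n) f g ?_
  refine FreeAlgebra.hom_ext ?_
  funext i
  exact h i

/-- The algebra endomorphism of `V_n` with `x_i ↦ x_{σ i}`. -/
def permHom (k : Type*) [Field k] {n : ℕ} (σ : Equiv.Perm (Fin n)) :
    SkewPoly k n →ₐ[k] SkewPoly k n :=
  lift (fun i => X k (σ i)) fun _ _ h => X_anticomm k (σ.injective.ne h)

theorem permHom_X (k : Type*) [Field k] {n : ℕ} (σ : Equiv.Perm (Fin n)) (i : Fin n) :
    permHom k σ (X k i) = X k (σ i) :=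
  lift_X _ _ i

theorem permHom_one (k : Type*) [Field k] (n : ℕ) :
    permHom k (1 : Equiv.Perm (Fin n)) = AlgHom.id k _ :=
  hom_ext fun i => by simp [permHom_X]

theorem permHom_mul (k : Type*) [Field k] {n : ℕ} (σ τ : Equiv.Perm (Fin n)) :
    permHom k (σ * τ) = (permHom k σ).comp (permHom k τ) :=
  hom_ext fun i => by simp [permHom_X]

/-- The permutation action of `S_n` on `V_n`: `σ • x_i = x_{σ i}`, extended linearly and
multiplicatively. -/
instance (k : Type*) [Field k] (n : ℕ) : MulSemiringAction (Equiv.Perm (Fin n)) (SkewPoly k n) where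
  smul σ a := permHom k σ a
  one_smul a := DFunLike.congr_fun (permHom_one k n) a
  mul_smul σ τ a := DFunLike.congr_fun (permHom_mul k σ τ) a
  smul_zero σ := map_zero (permHom k σ)
  smul_add σ := map_add (permHom k σ)
  smul_one σ := map_one (permHom k σ)
  smul_mul σ := map_mul (permHom k σ)

theorem smul_X (k : Type*) [Field k] {n : ℕ} (σ : Equiv.Perm (Fin n)) (i : Fin n) :
    σ • X k i = X k (σ i) :=
  permHom_X k σ i

instance (k : Type*) [Field k] (n : ℕ) : SMulCommClass (Equiv.Perm (Fin n)) k (SkewPoly k n) where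
  smul_comm σ c a := map_smul (permHom k σ) c a

end SkewPoly

end

/-! Write `y_i = x_i ^ 2`. These squares are central in `V_n`, and `V_n` is spanned over `k[y_1, …,
y_n]` by the square-free monomials. The map from the polynomial ring is injective, because `V_n`
maps to the Clifford algebra of the generic form `∑ y_i v_i ^ 2`, where the scalars embed. Hence
`V_n` has dimension `n` (`gkDim_eq`), and it remains to show that the quotient has dimension `n - 2`
(`gkDim_quotient_eq`).

Lower bound: for the transposition `τ` of two indices, killing the two corresponding variables is a
`τ`-invariant map `π`, so `∑ c_g # g ↦ π c_1 - π c_τ` vanishes on `(f)` (`map_coeff_eq_of_mem`). The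
other `n - 2` squares therefore stay algebraically independent in the quotient.

Upper bound: the growth of the quotient is controlled by the image of `k[y]`. Multiplying `f` by
squares on both sides and subtracting eliminates group elements one at a time; eliminating all but
`1` and `(i j)`, and then using anticommutativity, gives `y_i ∏ (y_{a(h)} - y_{h(a(h))}) ∈ (f)`, the
product over `h ≠ 1, (i j)` and the indices `a(h)` arbitrary (`X_mul_prod_mem_ker`). At a point of
the zero locus, either equalities between coordinates make two of them redundant, or at most one
pair `i, j` coincides; then the `a(h)` can be chosen with all factors nonzero, so `y_i = y_j = 0`.
Both cases leave dimension at most `n - 2`. -/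

noncomputable section

/-! ### Growth estimates for Gelfand–Kirillov dimension -/

section Growth

open Module Submodule

theorem Submodule.exists_le_of_monotone {k E : Type*} [Field k] [AddCommGroup E] [Module k E]
    {S : ℕ → Submodule k E} (hS : Monotone S) {V : Submodule k E} (hV : V.FG)
    (h : ∀ x ∈ V, ∃ e, x ∈ S e) : ∃ e, V ≤ S e := by
  obtain ⟨t, rfl⟩ := hV
  choose! e he using h
  refine ⟨t.sup e, span_le.2 fun x hx => hS (Finset.le_sup hx) (he x (subset_span hx))⟩

theorem Submodule.finrank_mul_le_mul {k E : Type*} [Field k] [Ring E] [Algebra k E]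
    (M N : Submodule k E) (hM : M.FG) (hN : N.FG) :
    finrank k ↥(M * N) ≤ finrank k M * finrank k N := by
  have := Module.Finite.iff_fg.2 hM
  have := Module.Finite.iff_fg.2 hN
  rw [← Submodule.mulMap_range, ← Module.finrank_tensorProduct]
  exact LinearMap.finrank_range_le _

theorem Submodule.finrank_le_of_le {k E : Type*} [Field k] [AddCommGroup E] [Module k E]
    {M N : Submodule k E} (hN : N.FG) (h : M ≤ N) : finrank k M ≤ finrank k N := by
  have := Module.Finite.iff_fg.2 hN
  exact Submodule.finrank_mono h

theorem Submodule.pow_monotone {k E : Type*} [Field k] [Ring E] [Algebra k E]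
    {V : Submodule k E} (h : 1 ∈ V) : Monotone fun m : ℕ => V ^ m :=
  monotone_nat_of_le_succ fun m => by
    rw [pow_succ]
    exact le_mul_of_one_le_right' (one_le.2 h)

/-- Every finite-dimensional `V` lies in some `V₀ ^ e`, so `V ^ N` lies in `V₀ ^ (e * N)`. The
resulting constant factor disappears on dividing its logarithm by `log N`. -/
theorem gkDim_le_of_finrank_pow_le {k E : Type*} [Field k] [Ring E] [Algebra k E]
    {V₀ : Submodule k E} (hfg : V₀.FG) (h1 : 1 ∈ V₀) (hgen : ∀ x : E, ∃ e, x ∈ V₀ ^ e)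
    {C s : ℕ} (hC : ∀ m, finrank k ↥(V₀ ^ m) ≤ C * (m + 1) ^ s) : gkDim k E ≤ s := by
  refine iSup_le fun ⟨V, hV, hV1⟩ => ?_
  obtain ⟨e, he⟩ := exists_le_of_monotone (pow_monotone h1) hV fun x _ => hgen x
  -- `(e + 1) ^ s` comes from `e * N + 1 ≤ (e + 1) * N`; `C + 1` in place of `C` makes `D` positive,
  -- so that `log D ≥ 0`.
  set D : ℕ := (C + 1) * (e + 1) ^ s with hD
  have hD1 : 1 ≤ D := Nat.one_le_iff_ne_zero.2 (by positivity)
  have hlim : Tendsto (fun N : ℕ => ((Real.log D / Real.log N + s : ℝ) : EReal)) atTop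
      (nhds ((s : ℝ) : EReal)) := by
    refine (continuous_coe_real_ereal.tendsto _).comp ?_
    have : Tendsto (fun N : ℕ => Real.log D / Real.log N) atTop (nhds 0) :=
      (Real.tendsto_log_atTop.comp tendsto_natCast_atTop_atTop).const_div_atTop _
    simpa using this.add_const (s : ℝ)
  have key : ∀ᶠ N : ℕ in atTop,
      ((Real.log (finrank k ↥(V ^ N)) / Real.log N : ℝ) : EReal) ≤
        ((Real.log D / Real.log N + s : ℝ) : EReal) := by
    filter_upwards [eventually_ge_atTop 2] with N hN
    have hN' : (2 : ℝ) ≤ N := by exact_mod_cast hN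
    have hlog : 0 < Real.log N := Real.log_pos (by linarith)
    have hle : finrank k ↥(V ^ N) ≤ D * N ^ s := by
      refine (finrank_le_of_le ((hfg.pow e).pow N) (pow_le_pow_left' he N)).trans ?_
      rw [← pow_mul]
      refine (hC _).trans ?_
      rw [hD, mul_assoc, ← mul_pow]
      have : e * N + 1 ≤ (e + 1) * N := by nlinarith
      gcongr
      omega
    have hle' : Real.log (finrank k ↥(V ^ N)) ≤ Real.log D + s * Real.log N := by
      rw [← Real.log_pow, ← Real.log_mul (by positivity) (by positivity)]
      -- Rank zero occurs for the zero algebra; there the value `log 0 = 0` is used.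
      rcases Nat.eq_zero_or_pos (finrank k ↥(V ^ N)) with h0 | h0
      · rw [h0, Nat.cast_zero, Real.log_zero]
        refine Real.log_nonneg ?_
        have : 1 ≤ D * N ^ s := Nat.one_le_iff_ne_zero.2 (by positivity)
        exact_mod_cast this
      · refine Real.log_le_log (by exact_mod_cast h0) ?_
        exact_mod_cast hle
    refine EReal.coe_le_coe_iff.2 ?_
    rw [div_add' _ _ _ hlog.ne']
    gcongr
  calc _ ≤ _ := limsup_le_limsup key
    _ = _ := hlim.limsup_eq
    _ = _ := by simp

namespace MvPolynomial

variable {k : Type*} [Field k] {s : ℕ}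

theorem restrictDegree_eq_span (m : ℕ) : restrictDegree (Fin s) k m =
    span k ((fun a => monomial a (1 : k)) '' {a : Fin s →₀ ℕ | ∀ i, a i ≤ m}) := by
  apply le_antisymm
  · intro p hp
    rw [mem_restrictDegree] at hp
    rw [p.as_sum]
    refine sum_mem fun a ha => ?_
    rw [← mul_one (coeff a p), ← smul_eq_mul, ← smul_monomial]
    exact smul_mem _ _ (subset_span ⟨a, hp a ha, rfl⟩)
  · rw [span_le]
    rintro _ ⟨a, ha, rfl⟩
    rw [SetLike.mem_coe, mem_restrictDegree]
    intro b hb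
    rw [Finset.mem_singleton.1 (support_monomial_subset hb)]
    exact ha

theorem finrank_restrictDegree (m : ℕ) :
    finrank k (restrictDegree (Fin s) k m) = (m + 1) ^ s := by
  rw [restrictDegree_eq_span, ← Subtype.range_coe (s := {a : Fin s →₀ ℕ | ∀ i, a i ≤ m}),
    ← Set.range_comp]
  let e : {a : Fin s →₀ ℕ | ∀ i, a i ≤ m} ≃ (Fin s → Fin (m + 1)) :=
    { toFun := fun a i => ⟨a.1 i, Nat.lt_succ_of_le (a.2 i)⟩
      invFun := fun b => ⟨Finsupp.equivFunOnFinite.symm fun i => b i,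
        fun i => Nat.le_of_lt_succ (b i).2⟩
      left_inv := fun a => by ext; simp
      right_inv := fun b => by ext; simp }
  have : Fintype {a : Fin s →₀ ℕ | ∀ i, a i ≤ m} := Fintype.ofEquiv _ e.symm
  rw [finrank_span_eq_card, Fintype.card_congr e]
  · simp
  · have := (basisMonomials (Fin s) k).linearIndependent.comp
      (Subtype.val : {a : Fin s →₀ ℕ | ∀ i, a i ≤ m} → _) Subtype.val_injective
    simpa [Function.comp_def] using this

theorem fg_restrictDegree (m : ℕ) : (restrictDegree (Fin s) k m).FG := by
  rw [← Module.Finite.iff_fg]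
  exact Module.finite_of_finrank_pos (by rw [finrank_restrictDegree]; positivity)

theorem one_mem_restrictDegree (m : ℕ) :
    (1 : MvPolynomial (Fin s) k) ∈ restrictDegree (Fin s) k m := by
  rw [restrictDegree_eq_span]
  exact subset_span ⟨0, by simp, rfl⟩

theorem restrictDegree_mul_le (a b : ℕ) :
    restrictDegree (Fin s) k a * restrictDegree (Fin s) k b ≤ restrictDegree (Fin s) k (a + b) := by
  simp only [restrictDegree_eq_span, span_mul_span]
  refine span_mono ?_
  rintro _ ⟨_, ⟨u, hu, rfl⟩, _, ⟨v, hv, rfl⟩, rfl⟩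
  exact ⟨u + v, fun i => add_le_add (hu i) (hv i), by simp [monomial_mul]⟩

/-- Bounding the degree in each variable separately makes the exponents a box, whose powers and
dimensions are exact: an exponent at most `m + 1` splits as `min a m` plus a remainder at most `1`.
-/
theorem restrictDegree_one_pow (m : ℕ) :
    restrictDegree (Fin s) k 1 ^ m = restrictDegree (Fin s) k m := by
  induction m with
  | zero =>
    rw [pow_zero, restrictDegree_eq_span, one_eq_span]
    congr 1
    ext p
    simp only [Set.mem_singleton_iff, Set.mem_image, Set.mem_ofPred_eq, Nat.le_zero]
    constructor
    · rintro rfl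
      exact ⟨0, by simp, rfl⟩
    · rintro ⟨a, ha, rfl⟩
      obtain rfl : a = 0 := Finsupp.ext ha
      rfl
  | succ m ih =>
    rw [pow_succ, ih]
    refine le_antisymm (restrictDegree_mul_le m 1) ?_
    simp only [restrictDegree_eq_span, span_mul_span]
    refine span_mono ?_
    rintro _ ⟨a, ha, rfl⟩
    let b : Fin s →₀ ℕ := Finsupp.equivFunOnFinite.symm fun i => min (a i) m
    refine ⟨_, ⟨b, fun i => min_le_right _ _, rfl⟩, _, ⟨a - b, fun i => ?_, rfl⟩, ?_⟩
    · have := ha i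
      simp only [Finsupp.coe_tsub, Pi.sub_apply, b, Finsupp.equivFunOnFinite_symm_apply_apply]
      omega
    · have hba : b ≤ a := fun i => by simp [b]
      have : b + (a - b) = a := add_tsub_cancel_of_le hba
      simp [monomial_mul, this]

theorem exists_mem_restrictDegree (p : MvPolynomial (Fin s) k) :
    ∃ m, p ∈ restrictDegree (Fin s) k m := by
  refine ⟨p.support.sup fun a => Finset.univ.sup a, ?_⟩
  rw [mem_restrictDegree]
  intro a ha i
  exact (Finset.le_sup (f := ⇑a) (Finset.mem_univ i)).trans
    (Finset.le_sup (f := fun a : Fin s →₀ ℕ => Finset.univ.sup a) ha)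

end MvPolynomial

/-- The image `V` of the box of side `1` satisfies `dim V ^ N = (N + 1) ^ s`. -/
theorem le_gkDim_of_injective {k E : Type*} [Field k] [Ring E] [Algebra k E] {s : ℕ}
    (φ : MvPolynomial (Fin s) k →ₐ[k] E) (hφ : Function.Injective φ) : (s : EReal) ≤ gkDim k E := by
  let V : Submodule k E := (MvPolynomial.restrictDegree (Fin s) k 1).map φ.toLinearMap
  have hV : V.FG ∧ 1 ∈ V := ⟨(MvPolynomial.fg_restrictDegree 1).map _,
    1, MvPolynomial.one_mem_restrictDegree 1, by simp⟩
  refine le_trans ?_ (le_iSup _ ⟨V, hV⟩)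
  refine le_limsup_of_frequently_le (Eventually.frequently ?_) (by isBoundedDefault)
  filter_upwards [eventually_ge_atTop 2] with N hN
  have hN' : (2 : ℝ) ≤ N := by exact_mod_cast hN
  have hlog : 0 < Real.log N := Real.log_pos (by linarith)
  have h1 : finrank k ↥(V ^ N) = (N + 1) ^ s := by
    rw [← Submodule.map_pow, MvPolynomial.restrictDegree_one_pow,
      ← (Submodule.equivMapOfInjective φ.toLinearMap hφ _).finrank_eq,
      MvPolynomial.finrank_restrictDegree]
  have : ((s : ℝ) : EReal) ≤ ((Real.log (finrank k ↥(V ^ N)) / Real.log N : ℝ) : EReal) := by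
    refine EReal.coe_le_coe_iff.2 ?_
    rw [h1, le_div_iff₀ hlog, ← Real.log_pow]
    refine Real.log_le_log (by positivity) ?_
    push_cast
    gcongr
    linarith
  simpa using this

/-- If `U` is spanned by `1` and module generators, then `V * U ≤ F ^ e * U` for some `e`, and
iterating gives `V ^ N * U ≤ F ^ (e * N) * U`. Since `1 ∈ U`, this bounds `V ^ N` itself. -/
theorem exists_finrank_pow_le_of_finite {k R : Type*} [Field k] [CommRing R] [Algebra k R] {s : ℕ}
    (φ : MvPolynomial (Fin s) k →ₐ[k] R) (hφ : φ.Finite) {V : Submodule k R} (hV : V.FG) :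
    ∃ C, ∀ N, finrank k ↥(V ^ N) ≤ C * (N + 1) ^ s := by
  classical
  let F : Submodule k R := (MvPolynomial.restrictDegree (Fin s) k 1).map φ.toLinearMap
  have hFpow : ∀ m, F ^ m = (MvPolynomial.restrictDegree (Fin s) k m).map φ.toLinearMap := fun m => by
    rw [← Submodule.map_pow, MvPolynomial.restrictDegree_one_pow]
  have hF1 : 1 ∈ F := ⟨1, MvPolynomial.one_mem_restrictDegree 1, by simp⟩
  obtain ⟨t, ht⟩ : ∃ t : Finset R, ∀ r : R, ∃ c : R → MvPolynomial (Fin s) k,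
      r = ∑ x ∈ t, φ (c x) * x := by
    let _ := φ.toRingHom.toAlgebra
    have hfin : Module.Finite (MvPolynomial (Fin s) k) R := hφ
    obtain ⟨t, ht⟩ := hfin
    refine ⟨t, fun r => ?_⟩
    have hr : r ∈ span (MvPolynomial (Fin s) k) (t : Set R) := ht ▸ mem_top
    obtain ⟨c, -, hc⟩ := mem_span_finset.1 hr
    exact ⟨c, hc.symm⟩
  let U : Submodule k R := span k (insert 1 t : Finset R)
  have hU : U.FG := ⟨_, rfl⟩
  have hU1 : 1 ∈ U := subset_span (by simp)
  have hmono : Monotone fun e : ℕ => F ^ e * U := fun a b hab =>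
    mul_le_mul' (pow_monotone hF1 hab) le_rfl
  obtain ⟨e, he⟩ := exists_le_of_monotone hmono (hV.mul hU) fun r _ => by
    obtain ⟨c, hc⟩ := ht r
    choose m hm using fun x => MvPolynomial.exists_mem_restrictDegree (c x)
    refine ⟨t.sup m, ?_⟩
    rw [hc]
    refine sum_mem fun x hx => hmono (Finset.le_sup hx) (mul_mem_mul ?_ (subset_span (by simp [hx])))
    rw [hFpow]
    exact ⟨_, hm x, rfl⟩
  have hVN : ∀ N, V ^ N * U ≤ F ^ (e * N) * U := fun N => by
    induction N with
    | zero => simp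
    | succ N ih =>
      calc V ^ (N + 1) * U = V ^ N * (V * U) := by rw [pow_succ, mul_assoc]
        _ ≤ V ^ N * (F ^ e * U) := by gcongr
        _ = F ^ e * (V ^ N * U) := by rw [mul_left_comm]
        _ ≤ F ^ e * (F ^ (e * N) * U) := by gcongr
        _ = _ := by rw [← mul_assoc, ← pow_add]; ring_nf
  have hFfg : ∀ m, (F ^ m).FG := fun m => ((MvPolynomial.fg_restrictDegree 1).map _).pow m
  refine ⟨(e + 1) ^ s * finrank k U, fun N => ?_⟩
  calc finrank k ↥(V ^ N) ≤ finrank k ↥(F ^ (e * N) * U) :=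
        finrank_le_of_le ((hFfg _).mul hU)
          ((le_mul_of_one_le_right' (one_le.2 hU1)).trans (hVN N))
    _ ≤ finrank k ↥(F ^ (e * N)) * finrank k U := finrank_mul_le_mul _ _ (hFfg _) hU
    _ ≤ (e * N + 1) ^ s * finrank k U := by
        gcongr
        rw [hFpow, ← MvPolynomial.finrank_restrictDegree (k := k)]
        have := Module.Finite.iff_fg.2 (MvPolynomial.fg_restrictDegree (k := k) (s := s) (e * N))
        exact finrank_map_le _ _
    _ ≤ ((e + 1) * (N + 1)) ^ s * finrank k U := by
        gcongr
        nlinarith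
    _ = _ := by rw [mul_pow]; ring

end Growth

/-! ### The dimension of `V_n`: central squares and square-free monomials -/

section SkewPolynomials

open Module Submodule

theorem exists_mem_pow_of_adjoin_eq_top {k E : Type*} [Field k] [Ring E] [Algebra k E] {s : Set E}
    (hs : Algebra.adjoin k s = ⊤) {V : Submodule k E} (hsV : s ⊆ V) (h1 : 1 ∈ V) (x : E) :
    ∃ e, x ∈ V ^ e := by
  have hx : x ∈ Algebra.adjoin k s := hs ▸ Algebra.mem_top
  induction hx using Algebra.adjoin_induction with
  | mem x hx => exact ⟨1, by rw [pow_one]; exact hsV hx⟩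
  | algebraMap r => exact ⟨0, by simp⟩
  | add x y _ _ hx hy =>
    obtain ⟨a, ha⟩ := hx
    obtain ⟨b, hb⟩ := hy
    exact ⟨max a b, add_mem (pow_monotone h1 (le_max_left a b) ha)
      (pow_monotone h1 (le_max_right a b) hb)⟩
  | mul x y _ _ hx hy =>
    obtain ⟨a, ha⟩ := hx
    obtain ⟨b, hb⟩ := hy
    exact ⟨a + b, by rw [pow_add]; exact mul_mem_mul ha hb⟩

namespace SkewPoly

variable (k : Type*) [Field k] (n : ℕ)

theorem adjoin_range_X : Algebra.adjoin k (Set.range (X k : Fin n → SkewPoly k n)) = ⊤ := by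
  rw [eq_top_iff]
  rintro x -
  obtain ⟨y, rfl⟩ := RingQuot.mkAlgHom_surjective k (SkewPolyRel k n) x
  change mk k n y ∈ _
  induction y using FreeAlgebra.induction with
  | grade0 r => rw [AlgHom.commutes]; exact Subalgebra.algebraMap_mem _ r
  | grade1 i => exact Algebra.subset_adjoin ⟨i, rfl⟩
  | mul a b ha hb => rw [map_mul]; exact mul_mem ha hb
  | add a b ha hb => rw [map_add]; exact add_mem ha hb

variable {k n}

theorem X_mul_X_swap {i j : Fin n} (h : i ≠ j) : X k i * X k j = -(X k j * X k i) :=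
  eq_neg_of_add_eq_zero_left (X_anticomm k h)

/-- Moving `x_j` past `x_i ^ 2` changes the sign twice. -/
theorem X_sq_mem_center (i : Fin n) : X k i ^ 2 ∈ Subalgebra.center k (SkewPoly k n) := by
  suffices h : Algebra.adjoin k (Set.range (X k)) ≤ Subalgebra.centralizer k {X k i ^ 2} by
    rw [adjoin_range_X] at h
    exact Subalgebra.mem_center_iff.2 fun b =>
      ((Subalgebra.mem_centralizer_iff k).1 (h (Algebra.mem_top (x := b))) _ rfl).symm
  refine Algebra.adjoin_le ?_
  rintro _ ⟨j, rfl⟩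
  refine (Subalgebra.mem_centralizer_iff k).2 ?_
  rintro _ rfl
  rcases eq_or_ne i j with rfl | h
  · rw [← pow_succ, ← pow_succ']
  · rw [pow_two, mul_assoc, X_mul_X_swap h, mul_neg, ← mul_assoc, X_mul_X_swap h, neg_mul, neg_neg,
      mul_assoc]

variable (k n)

/-- The homomorphism from the polynomial ring to the center of `V_n` with `y_i ↦ x_i ^ 2`. -/
def sqHomCenter : MvPolynomial (Fin n) k →ₐ[k] Subalgebra.center k (SkewPoly k n) :=
  MvPolynomial.aeval fun i => ⟨X k i ^ 2, X_sq_mem_center i⟩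

/-- The homomorphism from the polynomial ring to `V_n` with `y_i ↦ x_i ^ 2`. -/
def sqHom : MvPolynomial (Fin n) k →ₐ[k] SkewPoly k n :=
  (Subalgebra.center k (SkewPoly k n)).val.comp (sqHomCenter k n)

variable {k n}

theorem sqHom_X (i : Fin n) : sqHom k n (MvPolynomial.X i) = X k i ^ 2 := by
  simp [sqHom, sqHomCenter]

theorem sqHom_commute (p : MvPolynomial (Fin n) k) (a : SkewPoly k n) :
    Commute (sqHom k n p) a :=
  ((Subalgebra.mem_center_iff.1 (sqHomCenter k n p).2) a).symm

theorem smul_sqHom (σ : Equiv.Perm (Fin n)) (p : MvPolynomial (Fin n) k) :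
    σ • sqHom k n p = sqHom k n (MvPolynomial.rename σ p) := by
  change ((permHom k σ).comp (sqHom k n)) p = ((sqHom k n).comp (MvPolynomial.rename σ)) p
  congr 1
  ext i
  simp [sqHom_X, permHom_X]

variable (k n)

/-- The span of `1` and the variables of a polynomial ring. -/
def _root_.MvPolynomial.affineSpan : Submodule k (MvPolynomial (Fin n) k) :=
  span k (insert 1 (Set.range MvPolynomial.X))

/-- The span of `1, x_1, …, x_n`. -/
def genSpan : Submodule k (SkewPoly k n) := span k (insert 1 (Set.range (X k)))

variable {k n}

theorem _root_.MvPolynomial.fg_affineSpan : (MvPolynomial.affineSpan k n).FG :=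
  fg_span ((Set.finite_range _).insert _)

theorem fg_genSpan : (genSpan k n).FG := fg_span ((Set.finite_range _).insert _)

theorem one_mem_genSpan : 1 ∈ genSpan k n := subset_span (Set.mem_insert _ _)

theorem X_mem_genSpan (i : Fin n) : X k i ∈ genSpan k n :=
  subset_span (Set.mem_insert_of_mem _ ⟨i, rfl⟩)

/-- The span of the square-free monomials in the variables of a list. -/
def sqfreeSpan : List (Fin n) → Submodule k (SkewPoly k n)
  | [] => 1
  | i :: l => span k {1, X k i} * sqfreeSpan l

theorem fg_sqfreeSpan (l : List (Fin n)) : (sqfreeSpan (k := k) l).FG := by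
  induction l with
  | nil => exact ⟨{1}, by simp [sqfreeSpan, one_eq_span]⟩
  | cons i l ih => exact (fg_span (Set.toFinite _)).mul ih

theorem one_mem_sqfreeSpan (l : List (Fin n)) : 1 ∈ sqfreeSpan (k := k) l := by
  induction l with
  | nil => exact one_le.1 le_rfl
  | cons i l ih =>
    rw [← mul_one 1]
    exact mul_mem_mul (subset_span (by simp)) ih

theorem mul_map_sqHom (M : Submodule k (SkewPoly k n)) (N : Submodule k (MvPolynomial (Fin n) k)) :
    M * N.map (sqHom k n).toLinearMap = N.map (sqHom k n).toLinearMap * M := by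
  refine Submodule.mul_comm_of_commute ?_
  rintro a _ ha ⟨p, hp, rfl⟩
  exact (sqHom_commute p a).symm

/-- Move `x_j` to the right up to its own factor `span {1, x_j}`; the signs are absorbed by the
spans. There `x_j * x_j` is a central square and joins the polynomial part. -/
theorem X_mul_sqfreeSpan_le {l : List (Fin n)} {j : Fin n} (hj : j ∈ l) :
    span k {X k j} * sqfreeSpan l ≤
      (MvPolynomial.affineSpan k n).map (sqHom k n).toLinearMap * sqfreeSpan l := by
  set W := (MvPolynomial.affineSpan k n).map (sqHom k n).toLinearMap with hW
  have h1W : 1 ∈ W := ⟨1, subset_span (Set.mem_insert _ _), by simp⟩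
  have hXW : ∀ i, X k i ^ 2 ∈ W := fun i =>
    ⟨MvPolynomial.X i, subset_span (Set.mem_insert_of_mem _ ⟨i, rfl⟩), by simp [sqHom_X]⟩
  induction l with
  | nil => simp at hj
  | cons i l ih =>
    simp only [sqfreeSpan, ← mul_assoc]
    rcases List.mem_cons.1 hj with rfl | hj
    · refine mul_le_mul' ?_ le_rfl
      rw [span_mul_span, span_le]
      rintro _ ⟨_, rfl, _, rfl | rfl, rfl⟩
      · simpa using mul_mem_mul h1W (subset_span (R := k) (s := {1, X k j}) (Or.inr rfl))
      · simpa [pow_two] using mul_mem_mul (hXW j)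
          (subset_span (R := k) (s := {1, X k j}) (Or.inl rfl))
    · calc span k {X k j} * span k {1, X k i} * sqfreeSpan l
          ≤ span k {1, X k i} * span k {X k j} * sqfreeSpan l := by
            refine mul_le_mul' ?_ le_rfl
            rw [span_mul_span, span_le]
            have hj' := mem_span_singleton_self (R := k) (X k j)
            rintro _ ⟨_, rfl, _, rfl | rfl, rfl⟩
            · simpa using mul_mem_mul (subset_span (R := k) (s := {1, X k i}) (Or.inl rfl)) hj'
            · have := mul_mem_mul (subset_span (R := k) (s := {1, X k i}) (Or.inr rfl)) hj'
              rcases eq_or_ne i j with rfl | h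
              · exact this
              · change X k j * X k i ∈ _
                rw [X_mul_X_swap h.symm]
                exact neg_mem this
        _ ≤ span k {1, X k i} * (W * sqfreeSpan l) := by
            rw [mul_assoc]; exact mul_le_mul' le_rfl (ih hj)
        _ = W * span k {1, X k i} * sqfreeSpan l := by rw [← mul_assoc, hW, mul_map_sqHom]

/-- Each generator multiplies the square-free span at the cost of one factor from the span of `1`
and the squares; centrality lets these factors collect on the left. -/
theorem genSpan_pow_le (m : ℕ) : genSpan k n ^ m ≤
    (MvPolynomial.affineSpan k n ^ m).map (sqHom k n).toLinearMap *
      sqfreeSpan (List.finRange n) := by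
  set W := (MvPolynomial.affineSpan k n).map (sqHom k n).toLinearMap with hW
  set T : Submodule k (SkewPoly k n) := sqfreeSpan (List.finRange n)
  have hXT : genSpan k n * T ≤ W * T := by
    refine mul_le.2 fun a ha t ht => ?_
    induction ha using span_induction with
    | mem a ha =>
      rcases ha with rfl | ⟨j, rfl⟩
      · exact mul_mem_mul ⟨1, subset_span (Set.mem_insert _ _), by simp⟩ ht
      · exact X_mul_sqfreeSpan_le (List.mem_finRange j)
          (mul_mem_mul (mem_span_singleton_self _) ht)
    | zero => simp
    | add a b _ _ ha hb => rw [add_mul]; exact add_mem ha hb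
    | smul c a _ ha => rw [smul_mul_assoc]; exact smul_mem _ _ ha
  have key : genSpan k n ^ m * T ≤ W ^ m * T := by
    induction m with
    | zero => simp
    | succ m ih =>
      calc genSpan k n ^ (m + 1) * T = genSpan k n ^ m * (genSpan k n * T) := by
            rw [pow_succ, mul_assoc]
        _ ≤ genSpan k n ^ m * (W * T) := mul_le_mul' le_rfl hXT
        _ = W * (genSpan k n ^ m * T) := by rw [← mul_assoc, hW, mul_map_sqHom, mul_assoc]
        _ ≤ W * (W ^ m * T) := mul_le_mul' le_rfl ih
        _ = _ := by rw [← mul_assoc, pow_succ']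
  rw [Submodule.map_pow]
  exact (le_mul_of_one_le_right' (one_le.2 (one_mem_sqfreeSpan _))).trans key

theorem gkDim_le : gkDim k (SkewPoly k n) ≤ n := by
  obtain ⟨C, hC⟩ := exists_finrank_pow_le_of_finite (AlgHom.id k (MvPolynomial (Fin n) k))
    (AlgHom.Finite.id k _) MvPolynomial.fg_affineSpan
  have hWfg := fun m => (MvPolynomial.fg_affineSpan (k := k) (n := n)).pow m
  refine gkDim_le_of_finrank_pow_le (fg_genSpan (k := k)) one_mem_genSpan
    (exists_mem_pow_of_adjoin_eq_top (adjoin_range_X k n)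
      (fun _ h => subset_span (Set.mem_insert_of_mem _ h)) one_mem_genSpan)
    (C := C * finrank k (sqfreeSpan (k := k) (List.finRange n))) fun m => ?_
  calc _ ≤ _ := finrank_le_of_le (((hWfg m).map _).mul (fg_sqfreeSpan _)) (genSpan_pow_le m)
    _ ≤ _ := finrank_mul_le_mul _ _ ((hWfg m).map _) (fg_sqfreeSpan _)
    _ ≤ (C * (m + 1) ^ n) * finrank k (sqfreeSpan (k := k) (List.finRange n)) := by
        gcongr
        have := Module.Finite.iff_fg.2 (hWfg m)
        exact (finrank_map_le _ _).trans (hC m)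
    _ = _ := by ring

/-! ### Independence of the squares, through a Clifford algebra -/

variable (k n)

/-- The diagonal quadratic form whose coefficients are the variables of a polynomial ring. -/
abbrev genericForm : QuadraticForm (MvPolynomial (Fin n) k) (Fin n → MvPolynomial (Fin n) k) :=
  QuadraticMap.weightedSumSquares (MvPolynomial (Fin n) k)
    (MvPolynomial.X : Fin n → MvPolynomial (Fin n) k)

variable {k n}

theorem genericForm_apply (v : Fin n → MvPolynomial (Fin n) k) :
    genericForm k n v = ∑ i, MvPolynomial.X i * (v i * v i) :=
  QuadraticMap.weightedSumSquares_apply _ _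

/-- The homomorphism from `V_n` to the Clifford algebra of the generic diagonal form that sends
`x_i` to the `i`-th basis vector if `i ∈ s` and to zero otherwise. -/
def toClifford (s : Finset (Fin n)) : SkewPoly k n →ₐ[k] CliffordAlgebra (genericForm k n) :=
  lift (fun i => if i ∈ s then CliffordAlgebra.ι (genericForm k n) (Pi.single i 1) else 0) <| by
    intro i j hij
    split_ifs <;> try simp only [mul_zero, zero_mul, add_zero]
    rw [CliffordAlgebra.ι_mul_ι_add_swap, QuadraticMap.polar]
    simp only [genericForm_apply, ← Finset.sum_sub_distrib]
    rw [Finset.sum_eq_zero, map_zero]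
    intro l _
    rcases eq_or_ne l i with rfl | h
    · simp [hij]
    · simp [h]

theorem toClifford_X_of_notMem {s : Finset (Fin n)} {i : Fin n} (h : i ∉ s) :
    toClifford (k := k) s (X k i) = 0 := by
  simp [toClifford, lift_X, h]

theorem toClifford_sqHom_X {s : Finset (Fin n)} {i : Fin n} (h : i ∈ s) :
    toClifford s (sqHom k n (MvPolynomial.X i)) =
      algebraMap (MvPolynomial (Fin n) k) _ (MvPolynomial.X i) := by
  rw [sqHom_X, map_pow, toClifford, lift_X, if_pos h, pow_two, CliffordAlgebra.ι_sq_scalar]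
  congr 1
  simp [Pi.single_apply]

/-- As `2` is invertible, the Clifford algebra is linearly isomorphic to the exterior algebra, in
which the scalars are a direct summand. -/
theorem algebraMap_clifford_injective [CharZero k] : Function.Injective
    (algebraMap (MvPolynomial (Fin n) k) (CliffordAlgebra (genericForm k n))) := by
  have h2 : IsUnit (2 : MvPolynomial (Fin n) k) := by
    have := (IsUnit.mk0 (2 : k) two_ne_zero).map (algebraMap k (MvPolynomial (Fin n) k))
    rwa [map_ofNat] at this
  have := h2.invertible
  intro a b h
  have h' := congrArg (CliffordAlgebra.equivExterior (genericForm k n)) h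
  rw [Algebra.algebraMap_eq_smul_one, Algebra.algebraMap_eq_smul_one, map_smul, map_smul] at h'
  have h1 : CliffordAlgebra.equivExterior (genericForm k n) 1 = 1 := by simp
  rw [h1, ← Algebra.algebraMap_eq_smul_one, ← Algebra.algebraMap_eq_smul_one] at h'
  exact (ExteriorAlgebra.algebraMap_leftInverse _).injective h'

/-- Serves twice: with all variables kept, for `V_n`, and with two variables killed, for the
quotient. -/
theorem toClifford_sqHom_rename {m : ℕ} {s : Finset (Fin n)} {f : Fin m → Fin n}
    (hf : ∀ j, f j ∈ s) (p : MvPolynomial (Fin m) k) :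
    toClifford s (sqHom k n (MvPolynomial.rename f p)) =
      algebraMap (MvPolynomial (Fin n) k) _ (MvPolynomial.rename f p) := by
  change (((toClifford s).comp (sqHom k n)).comp (MvPolynomial.rename f)) p =
    ((IsScalarTower.toAlgHom k (MvPolynomial (Fin n) k)
      (CliffordAlgebra (genericForm k n))).comp (MvPolynomial.rename f)) p
  congr 1
  ext j
  simpa using toClifford_sqHom_X (hf j)

theorem gkDim_eq [CharZero k] : gkDim k (SkewPoly k n) = n := by
  refine le_antisymm gkDim_le (le_gkDim_of_injective (sqHom k n) fun a b h => ?_)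
  refine algebraMap_clifford_injective ?_
  have hid := fun p : MvPolynomial (Fin n) k => toClifford_sqHom_rename (k := k)
    (s := Finset.univ) (f := id) (by simp) p
  simp only [MvPolynomial.rename_id_apply] at hid
  rw [← hid, ← hid, h]

end SkewPoly

end SkewPolynomials

/-! ### Elements and non-elements of the ideal `(f)` -/

namespace SkewPoly

open MvPolynomial (rename)

/-- The algebra `(V_n # S_n) / (f)`. -/
abbrev PermQuotient (k : Type*) [Field k] (n : ℕ) : Type _ :=
  PertinencyQuotient (SkewPoly k n) (Equiv.Perm (Fin n))

/-- The two-sided ideal of `V_n # S_n` generated by the sum of the group elements. -/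
abbrev permIdeal (k : Type*) [Field k] (n : ℕ) :
    TwoSidedIdeal (SkewMonoidAlgebra (SkewPoly k n) (Equiv.Perm (Fin n))) :=
  TwoSidedIdeal.span {skewGroupSum (SkewPoly k n) (Equiv.Perm (Fin n))}

/-- The quotient map from the skew group algebra. -/
def quotHom (k : Type*) [Field k] (n : ℕ) :
    SkewMonoidAlgebra (SkewPoly k n) (Equiv.Perm (Fin n)) →ₐ[k] PermQuotient k n :=
  RingCon.mkₐ k (permIdeal k n).ringCon

/-- The inclusion of `V_n` in the skew group algebra. -/
def inclHom (k : Type*) [Field k] (n : ℕ) :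
    SkewPoly k n →ₐ[k] SkewMonoidAlgebra (SkewPoly k n) (Equiv.Perm (Fin n)) :=
  { SkewMonoidAlgebra.singleOneRingHom with commutes' := fun _ => rfl }

variable {k : Type*} [Field k] {n : ℕ}

theorem inclHom_apply (a : SkewPoly k n) : inclHom k n a = SkewMonoidAlgebra.single 1 a := rfl

theorem quotHom_surjective : Function.Surjective (quotHom k n) :=
  RingCon.mkₐ_surjective (α := k) (permIdeal k n).ringCon

theorem quotHom_eq_zero_iff {u : SkewMonoidAlgebra (SkewPoly k n) (Equiv.Perm (Fin n))} :
    quotHom k n u = 0 ↔ u ∈ permIdeal k n := by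
  rw [TwoSidedIdeal.mem_iff, ← RingCon.eq]
  rfl

theorem coeff_skewGroupSum (g : Equiv.Perm (Fin n)) :
    (skewGroupSum (SkewPoly k n) (Equiv.Perm (Fin n))).coeff g = 1 := by
  have h := map_sum (SkewMonoidAlgebra.coeffAddEquiv (k := SkewPoly k n) (G := Equiv.Perm (Fin n)))
    (fun g => SkewMonoidAlgebra.single g (1 : SkewPoly k n)) Finset.univ
  have h' := DFunLike.congr_fun h g
  rw [Finsupp.finsetSum_apply] at h'
  refine h'.trans ?_
  change ∑ x, (SkewMonoidAlgebra.single x (1 : SkewPoly k n)).coeff g = 1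
  simp

/-- If `π` is invariant under `τ`, then `∑ c_g # g ↦ π c_1 - π c_τ` vanishes on the ideal generated
by the sum of the group elements. -/
theorem map_coeff_eq_of_mem {C : Type*} [Ring C] [Algebra k C] (π : SkewPoly k n →ₐ[k] C)
    {τ : Equiv.Perm (Fin n)} (hπ : ∀ a : SkewPoly k n, π (τ • a) = π a)
    {u : SkewMonoidAlgebra (SkewPoly k n) (Equiv.Perm (Fin n))} (hu : u ∈ permIdeal k n) :
    π (u.coeff 1) = π (u.coeff τ) := by
  -- The statement with arbitrary `a`, `b` on both sides is stable under the two absorption steps,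
  -- so only the generator needs a computation.
  suffices h : ∀ a b : SkewMonoidAlgebra (SkewPoly k n) (Equiv.Perm (Fin n)),
      π ((a * u * b).coeff 1) = π ((a * u * b).coeff τ) by simpa using h 1 1
  induction hu using TwoSidedIdeal.span_induction with
  | mem x hx =>
    intro a b
    rw [Set.mem_singleton_iff] at hx
    subst hx
    induction a using SkewMonoidAlgebra.induction_on with
    | zero => simp
    | add a a' h h' => simp [add_mul, h, h']
    | single g α =>
      induction b using SkewMonoidAlgebra.induction_on with
      | zero => simp
      | add b b' h h' => simp only [mul_add, SkewMonoidAlgebra.coeff_add, Finsupp.add_apply, map_add,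
          h, h']
      | single h β =>
        -- The index `y` enters only through its action on `β`, so the coefficients at `1` and `τ`
        -- differ by `τ` acting on one factor, which `π` does not see.
        have hy : ∀ y, (SkewMonoidAlgebra.single g α * skewGroupSum (SkewPoly k n)
            (Equiv.Perm (Fin n)) * SkewMonoidAlgebra.single h β).coeff y = α * (y * h⁻¹) • β :=
          fun y => by
            rw [SkewMonoidAlgebra.coeff_mul_single, SkewMonoidAlgebra.coeff_single_mul,
              coeff_skewGroupSum, smul_one, mul_one]
        rw [hy, hy, one_mul, mul_smul, map_mul, map_mul, hπ]
  | zero => simp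
  | add x y _ _ hx hy => intro a b; simp [mul_add, add_mul, hx, hy]
  | neg x _ hx => intro a b; simp [hx]
  | left_absorb c x _ hx => intro a b; simpa [mul_assoc] using hx (a * c) b
  | right_absorb c x _ hx => intro a b; simpa [mul_assoc] using hx a (c * b)

/-- The homomorphism from the polynomial ring to `(V_n # S_n) / (f)` with `y_i ↦ x_i ^ 2`. -/
def sqQuotHom (k : Type*) [Field k] (n : ℕ) : MvPolynomial (Fin n) k →ₐ[k] PermQuotient k n :=
  ((quotHom k n).comp (inclHom k n)).comp (sqHom k n)

/-- Killing `x_0` and `x_1` is invariant under their transposition. A polynomial in the other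
squares has coefficient zero at the transposition, so if it lies in `(f)` its Clifford image is
zero. -/
theorem sqQuotHom_rename_injective [CharZero k] (m : ℕ) : Function.Injective
    ((sqQuotHom k (m + 2)).comp (rename fun j : Fin m => j.succ.succ)) := by
  rw [injective_iff_map_eq_zero]
  intro p hp
  let s : Finset (Fin (m + 2)) := Finset.univ.filter fun i => i ≠ 0 ∧ i ≠ 1
  have hs : ∀ j : Fin m, j.succ.succ ∈ s := fun j => by
    refine Finset.mem_filter.2 ⟨Finset.mem_univ _, Fin.succ_ne_zero _, fun h => ?_⟩
    exact Fin.succ_ne_zero j (Fin.succ_injective _ h)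
  have hinv : ∀ a : SkewPoly k (m + 2),
      toClifford s (Equiv.swap (0 : Fin (m + 2)) 1 • a) = toClifford s a := by
    have : (toClifford (k := k) s).comp (permHom k (Equiv.swap 0 1)) = toClifford s := by
      refine hom_ext fun i => ?_
      rw [AlgHom.comp_apply, permHom_X]
      have h0 : (0 : Fin (m + 2)) ∉ s := by simp [s]
      have h1 : (1 : Fin (m + 2)) ∉ s := by simp [s]
      rcases eq_or_ne i 0 with rfl | hi0
      · rw [Equiv.swap_apply_left, toClifford_X_of_notMem h0, toClifford_X_of_notMem h1]
      rcases eq_or_ne i 1 with rfl | hi1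
      · rw [Equiv.swap_apply_right, toClifford_X_of_notMem h0, toClifford_X_of_notMem h1]
      rw [Equiv.swap_apply_of_ne_of_ne hi0 hi1]
    exact fun a => DFunLike.congr_fun this a
  have h := map_coeff_eq_of_mem (toClifford s) hinv (quotHom_eq_zero_iff.1 hp)
  have h01 : (1 : Equiv.Perm (Fin (m + 2))) ≠ Equiv.swap 0 1 := fun h => by
    simpa using Equiv.congr_fun h 0
  rw [AlgHom.coe_toRingHom, AlgHom.coe_toRingHom, inclHom_apply, SkewMonoidAlgebra.coeff_single,
    Finsupp.single_eq_same, Finsupp.single_eq_of_ne h01.symm, map_zero] at h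
  have h' := (toClifford_sqHom_rename hs p).symm.trans h
  rw [map_eq_zero_iff _ algebraMap_clifford_injective] at h'
  refine MvPolynomial.rename_injective _ ?_ (h'.trans (map_zero _).symm)
  exact (Fin.succ_injective _).comp (Fin.succ_injective _)

theorem single_sub (g : Equiv.Perm (Fin n)) (a b : SkewPoly k n) :
    SkewMonoidAlgebra.single g (a - b) =
      SkewMonoidAlgebra.single g a - SkewMonoidAlgebra.single g b :=
  map_sub (SkewMonoidAlgebra.singleAddHom g) a b

/-- Right multiplication by `y_a` scales the term at `g` by `y_{g a}`, left multiplication by `y_{h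
a}` scales every term alike. Their difference kills the term at `g = h`. -/
theorem sum_single_mem (c : Equiv.Perm (Fin n) → MvPolynomial (Fin n) k) (h : Equiv.Perm (Fin n))
    (a : Fin n) (hc : ∑ g, SkewMonoidAlgebra.single g (sqHom k n (c g)) ∈ permIdeal k n) :
    ∑ g, SkewMonoidAlgebra.single g (sqHom k n
      (c g * (MvPolynomial.X (g a) - MvPolynomial.X (h a)))) ∈ permIdeal k n := by
  have h1 := (permIdeal k n).mul_mem_right _ (inclHom k n (sqHom k n (MvPolynomial.X a))) hc
  have h2 := (permIdeal k n).mul_mem_left (inclHom k n (sqHom k n (MvPolynomial.X (h a)))) _ hc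
  convert sub_mem h1 h2 using 1
  rw [Finset.sum_mul, Finset.mul_sum, ← Finset.sum_sub_distrib]
  refine Finset.sum_congr rfl fun g _ => ?_
  rw [inclHom_apply, inclHom_apply, SkewMonoidAlgebra.single_mul_single,
    SkewMonoidAlgebra.single_mul_single, mul_one, one_mul, one_smul, smul_sqHom,
    MvPolynomial.rename_X, ← map_mul, ← map_mul, ← single_sub, ← map_sub, mul_sub,
    mul_comm (MvPolynomial.X (h a))]

theorem sum_single_prod_mem (H : Finset (Equiv.Perm (Fin n))) (a : Equiv.Perm (Fin n) → Fin n) :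
    ∑ g, SkewMonoidAlgebra.single g (sqHom k n
      (∏ h ∈ H, (MvPolynomial.X (g (a h)) - MvPolynomial.X (h (a h))))) ∈ permIdeal k n := by
  classical
  induction H using Finset.induction_on with
  | empty =>
    simp only [Finset.prod_empty, map_one]
    exact TwoSidedIdeal.subset_span rfl
  | insert h H hh ih =>
    have := sum_single_mem _ h (a h) ih
    simp only [Finset.prod_insert hh]
    simpa only [mul_comm] using this

theorem X_mul_prod_mem_ker [CharZero k] {i j : Fin n} (hij : i ≠ j)
    (a : Equiv.Perm (Fin n) → Fin n) :
    MvPolynomial.X i * ∏ h ∈ Finset.univ \ {1, Equiv.swap i j},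
      (MvPolynomial.X (a h) - MvPolynomial.X (h (a h))) ∈ RingHom.ker (sqQuotHom k n) := by
  classical
  have h1τ : (1 : Equiv.Perm (Fin n)) ≠ Equiv.swap i j := fun h => by
    simpa [hij] using Equiv.congr_fun h i
  set H : Finset (Equiv.Perm (Fin n)) := Finset.univ \ {1, Equiv.swap i j} with hH
  set c : Equiv.Perm (Fin n) → MvPolynomial (Fin n) k := fun g =>
    ∏ h ∈ H, (MvPolynomial.X (g (a h)) - MvPolynomial.X (h (a h))) with hc
  have hmem : SkewMonoidAlgebra.single 1 (sqHom k n (c 1)) +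
      SkewMonoidAlgebra.single (Equiv.swap i j) (sqHom k n (c (Equiv.swap i j))) ∈
        permIdeal k n := by
    have h := sum_single_prod_mem (k := k) H a
    rwa [← Finset.sum_subset (Finset.subset_univ {1, Equiv.swap i j}),
      Finset.sum_pair h1τ] at h
    intro g _ hg
    rw [Finset.prod_eq_zero (i := g) (by rw [hH, Finset.mem_sdiff]; exact ⟨Finset.mem_univ _, hg⟩)
      (sub_self _), map_zero, SkewMonoidAlgebra.single_zero]
  -- Right multiplication by `x_i` minus left multiplication by `x_j`: as the transposition carries
  -- `x_i` to `x_j`, its term cancels.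
  have h2 : inclHom k n (sqHom k n (c 1) * (X k i - X k j)) ∈ permIdeal k n := by
    have hr := (permIdeal k n).mul_mem_right _ (inclHom k n (X k i)) hmem
    have hl := (permIdeal k n).mul_mem_left (inclHom k n (X k j)) _ hmem
    convert sub_mem hr hl using 1
    rw [inclHom_apply, inclHom_apply, inclHom_apply, add_mul, mul_add]
    simp only [SkewMonoidAlgebra.single_mul_single, mul_one, one_mul, one_smul, smul_X,
      Equiv.swap_apply_left]
    rw [← (sqHom_commute (c 1) (X k j)).eq, ← (sqHom_commute (c (Equiv.swap i j)) (X k j)).eq,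
      add_sub_add_right_eq_sub, mul_sub, single_sub]
  -- By anticommutativity, `x_i (x_i - x_j) + (x_i - x_j) x_i = 2 x_i ^ 2`.
  have h3 : inclHom k n (sqHom k n (c 1 * (2 * MvPolynomial.X i))) ∈ permIdeal k n := by
    have hr := (permIdeal k n).mul_mem_right _ (inclHom k n (X k i)) h2
    have hl := (permIdeal k n).mul_mem_left (inclHom k n (X k i)) _ h2
    convert add_mem hl hr using 1
    rw [← map_mul, ← map_mul, ← map_add, map_mul (sqHom k n), map_mul (sqHom k n), sqHom_X,
      map_ofNat, ← mul_assoc (X k i),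
      ← (sqHom_commute (c 1) (X k i)).eq, mul_assoc, mul_assoc, ← mul_add]
    congr 2
    have := X_anticomm k hij
    rw [mul_sub, sub_mul, pow_two, two_mul, eq_neg_of_add_eq_zero_left this]
    abel
  have h4 : c 1 * (2 * MvPolynomial.X i) ∈ RingHom.ker (sqQuotHom k n) :=
    quotHom_eq_zero_iff.2 h3
  have h5 := Ideal.mul_mem_left _ (MvPolynomial.C (2⁻¹ : k)) h4
  convert h5 using 1
  have : (MvPolynomial.C (2⁻¹ : k)) * 2 = (1 : MvPolynomial (Fin n) k) := by
    rw [← map_ofNat (MvPolynomial.C (σ := Fin n) (R := k)) 2, ← map_mul,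
      inv_mul_cancel₀ two_ne_zero, map_one]
  calc _ = (MvPolynomial.X i * c 1) * (MvPolynomial.C (2⁻¹ : k) * 2) := by
        rw [this, mul_one]; rfl
    _ = _ := by ring

end SkewPoly

/-! ### The dimension of the quotient -/

section PermutationQuotient

open Module Submodule

/-- Intended for the relation of equal coordinates: either two coordinates can be dropped because
others repeat them, or at most one pair coincides. With no coincidence at all, any pair serves as
`i, j`. -/
theorem Setoid.exists_pair_or_unique_pair {ι : Type*} [Nontrivial ι] (s : Setoid ι) :
    (∃ a b c d, a ≠ b ∧ c ≠ a ∧ c ≠ b ∧ d ≠ b ∧ s a c ∧ s b d) ∨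
      ∃ i j, i ≠ j ∧ ∀ a b, a ≠ b → s a b → (a = i ∧ b = j) ∨ (a = j ∧ b = i) := by
  by_cases h : ∃ i j, i ≠ j ∧ s i j
  · obtain ⟨i, j, hij, hs⟩ := h
    by_cases h' : ∀ a b, a ≠ b → s a b → (a = i ∧ b = j) ∨ (a = j ∧ b = i)
    · exact Or.inr ⟨i, j, hij, h'⟩
    · push Not at h'
      obtain ⟨a, b, hab, hsab, h1, h2⟩ := h'
      left
      by_cases ha : a = i ∨ a = j
      · have hb : b ≠ i ∧ b ≠ j := by grind
        exact ⟨i, b, j, a, hb.1.symm, hij.symm, hb.2.symm, hab, hs, s.symm hsab⟩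
      · push Not at ha
        exact ⟨i, a, j, b, ha.1.symm, hij.symm, ha.2.symm, hab.symm, hs, hsab⟩
  · push Not at h
    obtain ⟨i, j, hij⟩ := exists_pair_ne ι
    exact Or.inr ⟨i, j, hij, fun a b hab hs => absurd hs (h a b hab)⟩

/-- Otherwise every moved point is `i` or `j` and goes to the other one, which leaves only the
identity and the transposition. -/
theorem Equiv.Perm.exists_not_rel_apply {ι : Type*} [DecidableEq ι] {r : ι → ι → Prop} {i j : ι}
    (hr : ∀ a b, a ≠ b → r a b → (a = i ∧ b = j) ∨ (a = j ∧ b = i)) {h : Equiv.Perm ι}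
    (h1 : h ≠ 1) (h2 : h ≠ Equiv.swap i j) : ∃ a, ¬ r a (h a) := by
  by_contra! H
  have hmove : ∀ a, h a ≠ a → (a = i ∧ h a = j) ∨ (a = j ∧ h a = i) := fun a ha =>
    hr _ _ ha.symm (H a)
  obtain ⟨a, ha⟩ : ∃ a, h a ≠ a := by
    by_contra! hfix
    exact h1 (Equiv.ext hfix)
  have hha : h (h a) ≠ h a := fun h' => ha (h.injective h')
  refine h2 (Equiv.ext fun b => ?_)
  rw [Equiv.swap_apply_def]
  have hb := hmove b
  have ha' := hmove a ha
  have hha' := hmove _ hha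
  grind

theorem Submodule.mul_pow_le_pow_mul {k E : Type*} [Field k] [Ring E] [Algebra k E]
    {V Γ : Submodule k E} (hV : Γ * V ≤ V * Γ) (hΓ : Γ * Γ ≤ Γ) (h1 : 1 ∈ Γ) (m : ℕ) :
    (V * Γ) ^ m ≤ V ^ m * Γ := by
  induction m with
  | zero => simpa using h1
  | succ m ih =>
    calc (V * Γ) ^ (m + 1) = (V * Γ) ^ m * (V * Γ) := pow_succ _ _
      _ ≤ V ^ m * Γ * (V * Γ) := mul_le_mul' ih le_rfl
      _ = V ^ m * (Γ * V) * Γ := by simp only [mul_assoc]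
      _ ≤ V ^ m * (V * Γ) * Γ := mul_le_mul' (mul_le_mul' le_rfl hV) le_rfl
      _ = V ^ (m + 1) * (Γ * Γ) := by simp only [pow_succ, mul_assoc]
      _ ≤ _ := mul_le_mul' le_rfl hΓ

/-- Lying over, applied to the zero ideal of the domain `A`. It reduces a dimension bound for `R` to
one for a domain quotient of `R`. -/
theorem exists_isPrime_injective_comp {k A R : Type*} [Field k] [CommRing A] [IsDomain A]
    [Algebra k A] [CommRing R] [Algebra k R] {g : A →ₐ[k] R} (hinj : Function.Injective g)
    (hfin : g.Finite) :
    ∃ P : Ideal R, P.IsPrime ∧ Function.Injective ((Ideal.Quotient.mkₐ k P).comp g) := by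
  let _ := g.toRingHom.toAlgebra
  have : Module.Finite A R := hfin
  obtain ⟨P, -, hP, hPg⟩ := Ideal.exists_ideal_over_prime_of_isIntegral (⊥ : Ideal A) (⊥ : Ideal R)
    (by
      rw [← RingHom.ker_eq_comap_bot]
      exact ((RingHom.injective_iff_ker_eq_bot _).1 hinj).le)
  refine ⟨P, hP, ?_⟩
  rw [injective_iff_map_eq_zero]
  intro p hp
  have : g p ∈ P := Ideal.Quotient.eq_zero_iff_mem.1 hp
  change p ∈ P.comap (algebraMap A R) at this
  rwa [hPg, Ideal.mem_bot] at this

namespace SkewPoly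

universe u

variable {k : Type u} [Field k] {n : ℕ}

/-- If equalities among the images do not already give two redundant variables, each `h` outside
`{1, (i j)}` has a factor with nonzero image. The elements of `X_mul_prod_mem_ker` then force the
images of `y_i` and `y_j` to vanish, as `D` is a domain. -/
theorem exists_two_redundant_variables [CharZero k] [Nontrivial (Fin n)] {D : Type u} [CommRing D]
    [IsDomain D] [Algebra k D] (π : MvPolynomial (Fin n) k →ₐ[k] D)
    (hπ : ∀ p, sqQuotHom k n p = 0 → π p = 0) :
    ∃ a b : Fin n, a ≠ b ∧ ∀ S : Subalgebra k D,
      (∀ c, c ≠ a → c ≠ b → π (MvPolynomial.X c) ∈ S) →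
        π (MvPolynomial.X a) ∈ S ∧ π (MvPolynomial.X b) ∈ S := by
  classical
  rcases (Setoid.ker fun a => π (MvPolynomial.X a)).exists_pair_or_unique_pair with
    ⟨a, b, c, d, hab, hca, hcb, hdb, hac, hbd⟩ | ⟨i, j, hij, hu⟩
  · refine ⟨a, b, hab, fun S hS => ?_⟩
    have hac : π (MvPolynomial.X a) = π (MvPolynomial.X c) := hac
    have hbd : π (MvPolynomial.X b) = π (MvPolynomial.X d) := hbd
    have ha : π (MvPolynomial.X a) ∈ S := by
      rw [hac]
      exact hS c hca hcb
    refine ⟨ha, ?_⟩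
    rw [hbd]
    -- `d = a` is possible; there is no circularity, since `a` is already recovered from `c ≠ b`.
    rcases eq_or_ne d a with rfl | hda
    · exact ha
    · exact hS d hda hdb
  · have hex : ∀ h : Equiv.Perm (Fin n), ∃ a, h ∈ Finset.univ \ {1, Equiv.swap i j} →
        π (MvPolynomial.X a) ≠ π (MvPolynomial.X (h a)) := fun h => by
      by_cases hh : h ∈ Finset.univ \ {1, Equiv.swap i j}
      · simp only [Finset.mem_sdiff, Finset.mem_univ, true_and, Finset.mem_insert,
          Finset.mem_singleton, not_or] at hh
        obtain ⟨a, ha⟩ := Equiv.Perm.exists_not_rel_apply hu hh.1 hh.2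
        exact ⟨a, fun _ => ha⟩
      · exact ⟨i, fun h' => absurd h' hh⟩
    choose a ha using hex
    have hprod : π (∏ h ∈ Finset.univ \ {1, Equiv.swap i j},
        (MvPolynomial.X (a h) - MvPolynomial.X (h (a h)))) ≠ 0 := by
      rw [map_prod]
      refine Finset.prod_ne_zero_iff.2 fun h hh => ?_
      rw [map_sub]
      exact sub_ne_zero.2 (ha h hh)
    have hi : π (MvPolynomial.X i) = 0 := by
      have := hπ _ (X_mul_prod_mem_ker hij a)
      rw [map_mul] at this
      exact (mul_eq_zero.1 this).resolve_right hprod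
    have hj : π (MvPolynomial.X j) = 0 := by
      have := hπ _ (X_mul_prod_mem_ker hij.symm a)
      rw [map_mul, Equiv.swap_comm] at this
      exact (mul_eq_zero.1 this).resolve_right hprod
    exact ⟨i, j, hij, fun S _ => ⟨hi ▸ zero_mem S, hj ▸ zero_mem S⟩⟩

/-- The `n - 2` remaining variables still generate `D`, so its transcendence degree is at most `n -
2`. -/
theorem le_of_injective_of_ker_le [CharZero k] [Nontrivial (Fin n)] {D : Type u} [CommRing D]
    [IsDomain D] [Algebra k D] {π : MvPolynomial (Fin n) k →ₐ[k] D} (hsurj : Function.Surjective π)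
    (hπ : ∀ p, sqQuotHom k n p = 0 → π p = 0) {s : ℕ} {g : MvPolynomial (Fin s) k →ₐ[k] D}
    (hg : Function.Injective g) : s ≤ n - 2 := by
  obtain ⟨a, b, hab, hS⟩ := exists_two_redundant_variables π hπ
  let q : MvPolynomial {c : Fin n // c ∉ ({a, b} : Finset (Fin n))} k →ₐ[k] D :=
    π.comp (MvPolynomial.rename Subtype.val)
  have hq : Function.Surjective q := by
    rw [← AlgHom.range_eq_top, eq_top_iff, ← (AlgHom.range_eq_top π).2 hsurj]
    have hmem : ∀ c, c ≠ a → c ≠ b → π (MvPolynomial.X c) ∈ q.range := fun c hca hcb =>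
      ⟨MvPolynomial.X ⟨c, by simp [hca, hcb]⟩, by simp [q]⟩
    rintro _ ⟨p, rfl⟩
    have hX : ∀ i, π (MvPolynomial.X i) ∈ q.range := fun i => by
      by_cases hia : i = a
      · exact hia ▸ (hS _ hmem).1
      by_cases hib : i = b
      · exact hib ▸ (hS _ hmem).2
      exact hmem i hia hib
    change p ∈ q.range.comap π
    have : q.range.comap π = ⊤ := by
      rw [eq_top_iff, ← MvPolynomial.adjoin_range_X, Algebra.adjoin_le_iff]
      rintro _ ⟨i, rfl⟩
      exact hX i
    rw [this]
    trivial
  have h := (trdeg_le_of_injective g hg).trans (trdeg_le_of_surjective q hq)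
  rw [MvPolynomial.trdeg_of_isDomain, MvPolynomial.trdeg_of_isDomain, Cardinal.mk_fintype,
    Cardinal.mk_fintype, Cardinal.lift_natCast, Cardinal.lift_natCast, Nat.cast_le] at h
  have hcard : Fintype.card {c : Fin n // c ∉ ({a, b} : Finset (Fin n))} = n - 2 := by
    rw [Fintype.card_subtype, Finset.filter_notMem_eq_sdiff,
      Finset.card_sdiff_of_subset (Finset.subset_univ _), Finset.card_pair hab, Finset.card_univ, Fintype.card_fin]
  rwa [hcard, Fintype.card_fin] at h

theorem adjoin_range_X_union_range_single :
    Algebra.adjoin k (Set.range (fun i => quotHom k n (inclHom k n (X k i))) ∪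
    Set.range fun g : Equiv.Perm (Fin n) => quotHom k n (SkewMonoidAlgebra.single g 1)) = ⊤ := by
  rw [eq_top_iff]
  rintro x -
  obtain ⟨u, rfl⟩ := quotHom_surjective x
  set S := Algebra.adjoin k (Set.range (fun i => quotHom k n (inclHom k n (X k i))) ∪
    Set.range fun g : Equiv.Perm (Fin n) => quotHom k n (SkewMonoidAlgebra.single g 1))
  have hA : ∀ a, quotHom k n (inclHom k n a) ∈ S := fun a => by
    change a ∈ S.comap ((quotHom k n).comp (inclHom k n))
    have : S.comap ((quotHom k n).comp (inclHom k n)) = ⊤ := by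
      rw [eq_top_iff, ← adjoin_range_X, Algebra.adjoin_le_iff]
      rintro _ ⟨i, rfl⟩
      exact Algebra.subset_adjoin (Or.inl ⟨i, rfl⟩)
    rw [this]
    trivial
  induction u using SkewMonoidAlgebra.induction_on with
  | zero => rw [map_zero]; exact zero_mem _
  | add a b ha hb => rw [map_add]; exact add_mem ha hb
  | single g a =>
    have : SkewMonoidAlgebra.single g a = inclHom k n a * SkewMonoidAlgebra.single g 1 := by
      rw [inclHom_apply, SkewMonoidAlgebra.single_mul_single, one_mul, one_smul, mul_one]
    rw [this, map_mul]
    exact mul_mem (hA a) (Algebra.subset_adjoin (Or.inr ⟨g, rfl⟩))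

variable (k n)

/-- The span of the images of the group elements in `(V_n # S_n) / (f)`. -/
def permSpan : Submodule k (PermQuotient k n) :=
  span k (Set.range fun g : Equiv.Perm (Fin n) => quotHom k n (SkewMonoidAlgebra.single g 1))

variable {k n}

theorem fg_permSpan : (permSpan k n).FG := fg_span (Set.finite_range _)

theorem one_mem_permSpan : 1 ∈ permSpan k n := subset_span ⟨1, map_one (quotHom k n)⟩

theorem permSpan_mul_self : permSpan k n * permSpan k n ≤ permSpan k n := by
  rw [permSpan, span_mul_span, span_le]
  rintro _ ⟨_, ⟨g, rfl⟩, _, ⟨h, rfl⟩, rfl⟩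
  refine subset_span ⟨g * h, ?_⟩
  change _ = quotHom k n _ * quotHom k n _
  rw [← map_mul, SkewMonoidAlgebra.single_mul_single, smul_one, one_mul]

theorem permSpan_mul_genSpan :
    permSpan k n * (genSpan k n).map ((quotHom k n).comp (inclHom k n)).toLinearMap ≤
      (genSpan k n).map ((quotHom k n).comp (inclHom k n)).toLinearMap * permSpan k n := by
  rw [permSpan, genSpan, map_span, span_mul_span, span_le]
  rintro _ ⟨_, ⟨g, rfl⟩, _, ⟨a, ha, rfl⟩, rfl⟩
  have hg := subset_span (R := k) (Set.mem_range_self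
    (f := fun g : Equiv.Perm (Fin n) => quotHom k n (SkewMonoidAlgebra.single g 1)) g)
  have hcomm : quotHom k n (SkewMonoidAlgebra.single g 1) * quotHom k n (inclHom k n a) =
      quotHom k n (inclHom k n (g • a)) * quotHom k n (SkewMonoidAlgebra.single g 1) := by
    rw [← map_mul, ← map_mul, inclHom_apply, inclHom_apply, SkewMonoidAlgebra.single_mul_single,
      SkewMonoidAlgebra.single_mul_single, mul_one, one_mul, one_mul, one_smul, mul_one]
  change quotHom k n (SkewMonoidAlgebra.single g 1) * quotHom k n (inclHom k n a) ∈ _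
  rw [hcomm]
  refine mul_mem_mul (subset_span ⟨g • a, ?_, rfl⟩) hg
  rcases ha with rfl | ⟨i, rfl⟩
  · exact Or.inl (smul_one g)
  · exact Or.inr ⟨g i, (smul_X k g i).symm⟩

/-- Group elements move to the right because the span of `1, x_1, …, x_n` is stable under
permutations. What remains is the image of the polynomial ring times the fixed finite-dimensional
`T`, so the commutative image alone governs the growth. -/
theorem gkDim_quotient_le {s : ℕ} {C : ℕ}
    (hC : ∀ m, finrank k ↥((MvPolynomial.affineSpan k n ^ m).map (sqQuotHom k n).toLinearMap) ≤
      C * (m + 1) ^ s) : gkDim k (PermQuotient k n) ≤ s := by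
  set ρ : SkewPoly k n →ₐ[k] PermQuotient k n := (quotHom k n).comp (inclHom k n) with hρ
  set V : Submodule k (PermQuotient k n) := (genSpan k n).map ρ.toLinearMap with hV
  set T : Submodule k (PermQuotient k n) :=
    (sqfreeSpan (List.finRange n)).map ρ.toLinearMap * permSpan k n with hT
  have hTfg : T.FG := ((fg_sqfreeSpan _).map _).mul fg_permSpan
  have h1V : 1 ∈ V := ⟨1, one_mem_genSpan, by simp⟩
  have hpow : ∀ m, (V * permSpan k n) ^ m ≤
      (MvPolynomial.affineSpan k n ^ m).map (sqQuotHom k n).toLinearMap * T := by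
    intro m
    refine (Submodule.mul_pow_le_pow_mul permSpan_mul_genSpan permSpan_mul_self one_mem_permSpan
      m).trans ?_
    have h := Submodule.map_mono (f := ρ.toLinearMap) (genSpan_pow_le (k := k) (n := n) m)
    rw [Submodule.map_pow, Submodule.map_mul, ← Submodule.map_comp] at h
    rw [hT, ← mul_assoc]
    exact mul_le_mul' h le_rfl
  have hWfg : ∀ m, ((MvPolynomial.affineSpan k n ^ m).map (sqQuotHom k n).toLinearMap).FG :=
    fun m => (MvPolynomial.fg_affineSpan.pow m).map _
  have h1 : 1 ∈ V * permSpan k n := by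
    simpa using mul_mem_mul h1V (one_mem_permSpan (k := k) (n := n))
  refine gkDim_le_of_finrank_pow_le ((fg_genSpan.map _).mul fg_permSpan) h1
    (exists_mem_pow_of_adjoin_eq_top adjoin_range_X_union_range_single ?_ h1)
    (C := C * finrank k T) fun m => ?_
  · rintro _ (⟨i, rfl⟩ | ⟨g, rfl⟩)
    · have h : ρ (X k i) ∈ V := ⟨X k i, X_mem_genSpan i, rfl⟩
      have h' := mul_mem_mul h (one_mem_permSpan (k := k) (n := n))
      rwa [mul_one] at h'
    · have h : quotHom k n (SkewMonoidAlgebra.single g 1) ∈ permSpan k n := subset_span ⟨g, rfl⟩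
      have h' := mul_mem_mul h1V h
      rwa [one_mul] at h'
  · calc _ ≤ _ := finrank_le_of_le ((hWfg m).mul hTfg) (hpow m)
      _ ≤ _ := finrank_mul_le_mul _ _ (hWfg m) hTfg
      _ ≤ (C * (m + 1) ^ s) * finrank k T := by gcongr; exact hC m
      _ = _ := by ring

theorem gkDim_quotient_le_sub_two [CharZero k] [Nontrivial (Fin n)]
    [Nontrivial (PermQuotient k n)] : gkDim k (PermQuotient k n) ≤ (n - 2 : ℕ) := by
  let J := RingHom.ker (sqQuotHom k n)
  let R := MvPolynomial (Fin n) k ⧸ J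
  have : Nontrivial R := Ideal.Quotient.nontrivial_iff.2 (RingHom.ker_ne_top _)
  -- Noether normalization: `s` bounds the growth of `R`, and a domain quotient into which the `s`
  -- variables still embed shows `s ≤ n - 2`.
  obtain ⟨s, g, hginj, hgfin⟩ := exists_finite_inj_algHom_of_fg k R
  have hs : s ≤ n - 2 := by
    obtain ⟨P, hP, hPg⟩ := exists_isPrime_injective_comp hginj hgfin
    refine le_of_injective_of_ker_le (π := (Ideal.Quotient.mkₐ k P).comp (Ideal.Quotient.mkₐ k J))
      ((Ideal.Quotient.mkₐ_surjective k P).comp (Ideal.Quotient.mkₐ_surjective k J))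
      (fun p hp => ?_) hPg
    rw [AlgHom.comp_apply, Ideal.Quotient.mkₐ_eq_mk k J, Ideal.Quotient.eq_zero_iff_mem.2 hp,
      map_zero]
  obtain ⟨C, hC⟩ := exists_finrank_pow_le_of_finite g hgfin
    (MvPolynomial.fg_affineSpan.map (Ideal.Quotient.mkₐ k J).toLinearMap)
  refine le_trans (gkDim_quotient_le (C := C) (s := s) fun m => ?_) (by exact_mod_cast hs)
  refine le_trans ?_ (hC m)
  have hfac : sqQuotHom k n = (Ideal.kerLiftAlg (sqQuotHom k n)).comp (Ideal.Quotient.mkₐ k J) := by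
    ext; rfl
  have hfg := (MvPolynomial.fg_affineSpan (k := k) (n := n).map
    (Ideal.Quotient.mkₐ k J).toLinearMap).pow m
  have := Module.Finite.iff_fg.2 hfg
  rw [hfac, AlgHom.comp_toLinearMap, Submodule.map_comp, Submodule.map_pow]
  exact finrank_map_le _ _

theorem gkDim_quotient_eq [CharZero k] (m : ℕ) : gkDim k (PermQuotient k (m + 2)) = m := by
  have hinj := sqQuotHom_rename_injective (k := k) m
  -- The embedded polynomial ring shows that the quotient is nonzero, which the upper bound requires
  -- for Noether normalization.
  have : Nontrivial (PermQuotient k (m + 2)) := hinj.nontrivial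
  exact le_antisymm gkDim_quotient_le_sub_two (le_gkDim_of_injective _ hinj)

end SkewPoly

end PermutationQuotient

end

theorem corollary3p6 (k : Type*) [Field k] [IsAlgClosed k] [CharZero k] (n : ℕ) (hn : 2 ≤ n) :
    pertinency k (SkewPoly k n) (Equiv.Perm (Fin n)) = 2 := by
  obtain ⟨m, rfl⟩ := Nat.exists_eq_add_of_le' hn
  rw [pertinency, SkewPoly.gkDim_eq, SkewPoly.gkDim_quotient_eq]
  have h : (((m + 2 : ℕ) : ℝ) : EReal) - ((m : ℝ) : EReal) = ((2 : ℕ) : ℝ) := by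
    rw [← EReal.coe_sub, Nat.cast_add, add_sub_cancel_left]
  simp only [EReal.coe_natCast] at h
  exact h.trans Nat.cast_ofNat
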